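/- A Euclidean function on a commutative domain $R$ is a function $f$ from $R\setminus\{0\}$ to a well-ordered set having $\mathbb{N}$ as an initial segment, such that for all $a,b\in R\setminus\{0\}$ there are $q,r\in R$ with $a=qb+r$ and either $r=0$ or $f(r)<f(b)$. Let $\varphi_{\mathbb{Z}[i]}$ be the minimal Euclidean function on $\mathbb{Z}[i]$, that is, the pointwise minimum of all Euclidean functions on $\mathbb{Z}[i]\setminus\{0\}$. For $z\in\mathbb{Z}[i]\setminus\{0\}$ let $v_2(z)$ be the largest $c\ge 0$ with $2^c\mid z$ in $\mathbb{Z}[i]$, and put $v_2(0)=\infty$. For $a,b\in\mathbb{Z}[i]\setminus\{0\}$ the Gauss quotient $q$ of $a$ by $b$ is obtained from $a/b$ by rounding its real and its imaginary part to nearest integers (half-integers are rounded down), and the Gauss remainder is $r=a-qb$. Let $a,b\in\mathbb{Z}[i]\setminus\{0\}$ have Gauss remainder $r$. 1. If $v_2(r)\le v_2(b)$, then $r\ne 0$ and $\varphi_{\mathbb{Z}[i]}(r)<\varphi_{\mathbb{Z}[i]}(b)$. 2. In particular, if $v_2(a)<v_2(b)$, then $r\neq 0$ and $\varphi_{\mathbb{Z}[i]}(r)<\varphi_{\mathbb{Z}[i]}(b)$,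 so in that case the Gauss remainder is already a remainder for the minimal Euclidean function. -/

import Mathlib

/-- A function `f` on the nonzero elements of a commutative ring `R`, with values in a
well-ordered type `W`, is a Euclidean function if for all nonzero `a`, `b` there are `q`, `r`
with `a = q * b + r` and either `r = 0` or `f r < f b`. -/
def IsEuclideanFunction {R : Type*} [CommRing R] {W : Type*} [LinearOrder W] [WellFoundedLT W]
    (f : {x : R // x ≠ 0} → W) : Prop :=
  ∀ a b : {x : R // x ≠ 0}, ∃ q r : R, a.1 = q * b.1 + r ∧
    (r = 0 ∨ ∃ hr : r ≠ 0, f ⟨r, hr⟩ < f b)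

/-- The minimal Euclidean function `φ_R`: the pointwise minimum of all Euclidean functions on
`R ∖ {0}`.  A value in a well-ordered set that has `ℕ` as an initial segment is recorded as the
corresponding ordinal.  (The set below is nonempty exactly when `R` has such a function.) -/
noncomputable def minimalEuclideanFunction.{u} {R : Type u} [CommRing R]
    (x : {x : R // x ≠ 0}) : Ordinal.{u} :=
  sInf {w : Ordinal.{u} | ∃ f : {x : R // x ≠ 0} → Ordinal.{u}, IsEuclideanFunction f ∧ f x = w}

/-- The nearest integer function that rounds half-integers down. (Mathlib's `round` rounds
them up.) -/
def nint (x : ℚ) : ℤ :=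
  if x - ⌊x⌋ ≤ 1 / 2 then ⌊x⌋ else ⌈x⌉

/-- The Gauss quotient of `a` by `b ≠ 0`: round the real and imaginary parts of
`a / b = a * conj b / Nm b` to nearest integers. -/
def gaussQuotient (a b : GaussianInt) : GaussianInt :=
  ⟨nint (((a * star b).re : ℚ) / (b.norm : ℚ)), nint (((a * star b).im : ℚ) / (b.norm : ℚ))⟩

/-- The Gauss remainder of `a` by `b ≠ 0`, so that `a = q * b + r` with the Gauss quotient `q`. -/
def gaussRemainder (a b : GaussianInt) : GaussianInt :=
  a - gaussQuotient a b * b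

/-! The minimal Euclidean function has an explicit octagonal description. Let w_n run through 3, 4,
6, 8, 12, 16, … and let k = v_2(z). Then z ≠ 0 has level at most n when |re z|, |im z| ≤ w_n - 2·2^k
and |re z| + |im z| ≤ w_{n+1} - 3·2^k. The least level equals the minimal function
(`minimalEuclideanFunction_eq_level`).

The level is itself Euclidean by `HasLevel.exists_sub`. Conversely, no Euclidean function f is
smaller. Up to a unit, g = (1+i)^n has the property that g and all g - x with x of level below n
have level at most n (`exists_hasLevel_sub`). If f b ≤ n, dividing g by b makes b a divisor of such
an element, and levels pass to divisors (`HasLevel.of_mul`).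

For the theorem, a Gauss remainder satisfies r/b ∈ [-1/2, 1/2]², which confines r to an octagon
determined by b. If v_2(r) ≤ v_2(b), these bounds, sharpened by divisibility by 2^k, lower the level
(`HasLevel.of_near`). If v_2(a) < v_2(b), then v_2(r) = v_2(a), so the second claim follows from the
first. -/

/-! ### Integer inequalities for moving points into an octagon. -/

theorem Int.add_le_of_dvd_of_lt {k a b : ℤ} (ha : k ∣ a) (hb : k ∣ b) (h : a < b) : a + k ≤ b := by
  have := Int.le_of_dvd (by omega) (dvd_sub hb ha)
  omega

theorem abs_add_abs_le_iff {a b m : ℤ} :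
    |a| + |b| ≤ m ↔ a + b ≤ m ∧ a - b ≤ m ∧ b - a ≤ m ∧ -a - b ≤ m := by
  rcases abs_cases a with h | h <;> rcases abs_cases b with h' | h' <;> omega

/-- If `c + d i` is close to `x + y i` and just outside an octagon shrunk by `K`, then subtracting
`x + y i` or `i (x + y i)` moves it into the unshrunk octagon. -/
theorem octagon_translate_of_dvd {w w' W K x y c d : ℤ}
    (hw : (w = 3 * W ∧ w' = 4 * W) ∨ (w = 4 * W ∧ w' = 6 * W))
    (hK : 2 ∣ K) (hK0 : 0 < K) (hKW : K ∣ W)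
    (hc : K ∣ c) (hd : K ∣ d) (hy : 0 ≤ y) (hyx : y ≤ x)
    (hxy : ¬ (2 ∣ x ∧ 2 ∣ y)) (hx : x ≤ w' - 2) (hs : x + y ≤ 2 * w - 3)
    (hcd : |c| ≤ d) (h1 : 2 * d ≤ x + y) (h2 : |c| + d ≤ x)
    (hbad : w - 2 * K < d ∨ w' - 3 * K < |c| + d) (hW : 0 < W) :
    (|c - x| ≤ w - 2 ∧ |d - y| ≤ w - 2 ∧ |c - x| + |d - y| ≤ w' - 3) ∨
    (|c + y| ≤ w - 2 ∧ |d - x| ≤ w - 2 ∧ |c + y| + |d - x| ≤ w' - 3) := by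
  have hKw : K ∣ w := by rcases hw with h | h <;> exact h.1 ▸ hKW.mul_left _
  have hKw' : K ∣ w' := by rcases hw with h | h <;> exact h.2 ▸ hKW.mul_left _
  have hdw := Int.add_le_of_dvd_of_lt hd hKw (by omega)
  have hKW' : K ≤ W := Int.le_of_dvd hW hKW
  -- Since K divides c, d, w and w', `hbad` leaves only d = w - K, or |c| + d equal to w' - K or w'
  -- - 2K; linear arithmetic settles these cases.
  have e1 : d + K ≤ w - K ∨ d = w - K := by
    rcases (show d ≤ w - K by omega).lt_or_eq with h | h
    · exact .inl (Int.add_le_of_dvd_of_lt hd (dvd_sub hKw dvd_rfl) h)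
    · exact .inr h
  have key : ∀ s, K ∣ s → s < w' → s ≤ w' - 3 * K ∨ s = w' - 2 * K ∨ s = w' - K := by
    intro s hs h
    have a1 := Int.add_le_of_dvd_of_lt hs hKw' h
    rcases (show s ≤ w' - K by omega).lt_or_eq with h | h
    · have a2 := Int.add_le_of_dvd_of_lt hs (dvd_sub hKw' dvd_rfl) h
      rcases (show s ≤ w' - K - K by omega).lt_or_eq with h | h
      · have a3 := Int.add_le_of_dvd_of_lt hs (dvd_sub (dvd_sub hKw' dvd_rfl) dvd_rfl) h
        omega
      · omega
    · omega
  have e2 : d - c ≤ 2 * W - K ∨ 2 * W ≤ d - c := by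
    rcases lt_or_ge (d - c) (2 * W) with h | h
    · have := Int.add_le_of_dvd_of_lt (dvd_sub hd hc) (hKW.mul_left 2) h
      omega
    · omega
  rcases le_or_gt 0 c with hc0 | hc0
  · rw [abs_of_nonneg hc0] at hcd h2 hbad
    have e3 := key (c + d) (dvd_add hc hd) (by omega)
    simp only [abs_add_abs_le_iff, abs_le]
    rcases hw with ⟨rfl, rfl⟩ | ⟨rfl, rfl⟩ <;> omega
  · rw [abs_of_neg hc0] at hcd h2 hbad
    have e3 := key (d - c) (dvd_sub hd hc) (by omega)
    simp only [abs_add_abs_le_iff, abs_le]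
    rcases hw with ⟨rfl, rfl⟩ | ⟨rfl, rfl⟩ <;> omega

/-- The extreme valuation, where K no longer divides W. Here d < w ≤ 2K forces d = K and c ∈ {0, K,
-K}, so few points remain. -/
theorem octagon_translate_of_eq_two_mul {w w' W K x y c d : ℤ}
    (hw : (w = 3 * W ∧ w' = 4 * W) ∨ (w = 4 * W ∧ w' = 6 * W))
    (hK : K = 2 * W)
    (hc : K ∣ c) (hd : K ∣ d) (hy : 0 ≤ y) (hyx : y ≤ x)
    (hxy : ¬ (2 ∣ x ∧ 2 ∣ y)) (hx : x ≤ w' - 2) (hs : x + y ≤ 2 * w - 3) (hd0 : 0 < d)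
    (hcd : |c| ≤ d) (h1 : 2 * d ≤ x + y) (h2 : |c| + d ≤ x) :
    (|c - x| ≤ w - 2 ∧ |d - y| ≤ w - 2 ∧ |c - x| + |d - y| ≤ w' - 3) ∨
    (|c + y| ≤ w - 2 ∧ |d - x| ≤ w - 2 ∧ |c + y| + |d - x| ≤ w' - 3) := by
  have hdK : d = K := by
    rcases (Int.le_of_dvd hd0 hd).eq_or_lt with h | h
    · exact h.symm
    · have := Int.add_le_of_dvd_of_lt dvd_rfl hd h
      omega
  have hcK : c = 0 ∨ c = K ∨ c = -K := by
    rw [hdK, abs_le] at hcd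
    rcases lt_trichotomy c 0 with h | h | h
    · have := Int.add_le_of_dvd_of_lt hc (dvd_zero K) h
      omega
    · exact .inl h
    · have := Int.le_of_dvd h hc
      omega
  simp only [abs_add_abs_le_iff, abs_le]
  have h3 := abs_nonneg c
  have h4 := le_abs_self c
  have h5 := neg_abs_le c
  rcases hw with ⟨rfl, rfl⟩ | ⟨rfl, rfl⟩ <;> rcases hcK with h | h | h <;> omega

/-! ### Octagon widths. -/

/-- The sequence `3, 4, 6, 8, 12, 16, …` of octagon widths. -/
def octagonWidth : ℕ → ℤ
  | 0 => 3
  | 1 => 4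
  | n + 2 => 2 * octagonWidth n

theorem octagonWidth_cases (n : ℕ) : ∃ t : ℕ,
    (n = 2 * t ∧ octagonWidth n = 3 * 2 ^ t ∧ octagonWidth (n + 1) = 4 * 2 ^ t) ∨
    (n = 2 * t + 1 ∧ octagonWidth n = 4 * 2 ^ t ∧ octagonWidth (n + 1) = 6 * 2 ^ t) := by
  induction n using Nat.twoStepInduction with
  | zero => exact ⟨0, .inl (by simp [octagonWidth])⟩
  | one => exact ⟨0, .inr (by simp [octagonWidth])⟩
  | more n ih _ =>
    obtain ⟨t, ⟨h1, h2, h3⟩ | ⟨h1, h2, h3⟩⟩ := ih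
    · refine ⟨t + 1, .inl ⟨by omega, ?_, ?_⟩⟩
      · rw [octagonWidth, h2]; ring
      · rw [octagonWidth, h3]; ring
    · refine ⟨t + 1, .inr ⟨by omega, ?_, ?_⟩⟩
      · rw [octagonWidth, h2]; ring
      · rw [octagonWidth, h3]; ring

theorem octagonWidth_mono : Monotone octagonWidth := by
  refine monotone_nat_of_le_succ fun n => ?_
  obtain ⟨t, h⟩ := octagonWidth_cases n
  have : (0 : ℤ) < 2 ^ t := by positivity
  omega

/-! ### Levels, their symmetries and divisibility by powers of 2. -/

namespace GaussianInt

/-- The octagon of level `n`, shrunk proportionally to `K`. -/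
def InOctagon (n : ℕ) (K : ℤ) (z : GaussianInt) : Prop :=
  |z.re| ≤ octagonWidth n - 2 * K ∧ |z.im| ≤ octagonWidth n - 2 * K ∧
    |z.re| + |z.im| ≤ octagonWidth (n + 1) - 3 * K

/-- The nonzero Gaussian integers of level at most `n`. -/
def HasLevel (n : ℕ) (z : GaussianInt) : Prop :=
  ∃ k : ℕ, ¬ 2 ^ (k + 1) ∣ z ∧ InOctagon n (2 ^ k) z

/-- The imaginary unit. -/
def I : GaussianInt := ⟨0, 1⟩

@[simp] theorem I_mul_re (z : GaussianInt) : (I * z).re = -z.im := by simp [I]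
@[simp] theorem I_mul_im (z : GaussianInt) : (I * z).im = z.re := by simp [I]
theorem I_mul_I : I * I = -1 := by ext <;> simp [I]

theorem rotation_induction {P : GaussianInt → Prop} (hI : ∀ z, P (I * z) → P z)
    (h : ∀ z : GaussianInt, |z.re| ≤ z.im → P z) (z : GaussianInt) : P z := by
  have hz : |z.re| ≤ z.im ∨ |z.re| ≤ -z.im ∨ |z.im| ≤ z.re ∨ |z.im| ≤ -z.re := by
    simp only [abs_le]
    omega
  rcases hz with hz | hz | hz | hz
  · exact h z hz
  · exact hI _ (hI _ (h _ (by simpa only [I_mul_re, I_mul_im, abs_neg, neg_neg] using hz)))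
  · exact hI _ (h _ (by simpa only [I_mul_re, I_mul_im, abs_neg, neg_neg] using hz))
  · exact hI _ (hI _ (hI _ (h _ (by simpa only [I_mul_re, I_mul_im, abs_neg, neg_neg] using hz))))

/-- The units and conjugation generate the symmetry group of the square lattice, for which 0 ≤ im ≤
re is a fundamental domain. -/
theorem symm_induction {P : GaussianInt → Prop} (hI : ∀ z, P (I * z) → P z)
    (hstar : ∀ z, P (star z) → P z) (h : ∀ z : GaussianInt, 0 ≤ z.im → z.im ≤ z.re → P z)
    (z : GaussianInt) : P z := by
  have h' : ∀ z : GaussianInt, |z.im| ≤ z.re → P z := by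
    intro z hz
    rcases le_total 0 z.im with h0 | h0
    · exact h z h0 ((le_abs_self _).trans hz)
    · refine hstar z (h _ ?_ ?_)
      · simpa using h0
      · simpa using (neg_le_abs _).trans hz
  refine rotation_induction hI (fun z hz => hI _ (hI _ (hI _ (h' _ ?_)))) z
  simpa only [I_mul_re, I_mul_im, abs_neg, neg_neg] using hz

theorem two_pow_dvd_iff {k : ℕ} {z : GaussianInt} :
    (2 : GaussianInt) ^ k ∣ z ↔ (2 : ℤ) ^ k ∣ z.re ∧ (2 : ℤ) ^ k ∣ z.im := by
  rw [← Zsqrtd.intCast_dvd]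
  push_cast
  rfl

theorem dvd_I_mul_iff {a z : GaussianInt} : a ∣ I * z ↔ a ∣ z := by
  refine ⟨fun h => ?_, fun h => h.mul_left _⟩
  have : a ∣ I * (I * z) := h.mul_left _
  rwa [← mul_assoc, I_mul_I, neg_one_mul, dvd_neg] at this

theorem two_pow_dvd_star_iff {k : ℕ} {z : GaussianInt} :
    (2 : GaussianInt) ^ k ∣ star z ↔ 2 ^ k ∣ z := by
  simp [two_pow_dvd_iff]

theorem inOctagon_I_mul_iff {n : ℕ} {K : ℤ} {z : GaussianInt} :
    InOctagon n K (I * z) ↔ InOctagon n K z := by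
  simp only [InOctagon, I_mul_re, I_mul_im, abs_neg, add_comm |z.im|]
  tauto

theorem inOctagon_star_iff {n : ℕ} {K : ℤ} {z : GaussianInt} :
    InOctagon n K (star z) ↔ InOctagon n K z := by
  simp [InOctagon]

theorem hasLevel_I_mul_iff {n : ℕ} {z : GaussianInt} : HasLevel n (I * z) ↔ HasLevel n z := by
  simp only [HasLevel, dvd_I_mul_iff, inOctagon_I_mul_iff]

theorem hasLevel_star_iff {n : ℕ} {z : GaussianInt} : HasLevel n (star z) ↔ HasLevel n z := by
  simp only [HasLevel, two_pow_dvd_star_iff, inOctagon_star_iff]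

theorem HasLevel.ne_zero {n : ℕ} {z : GaussianInt} (h : HasLevel n z) : z ≠ 0 := by
  rintro rfl
  obtain ⟨k, hk, -⟩ := h
  exact hk (dvd_zero _)

theorem InOctagon.mono {m n : ℕ} {K L : ℤ} {z : GaussianInt} (hmn : m ≤ n) (hKL : L ≤ K)
    (h : InOctagon m K z) : InOctagon n L z := by
  have h1 := octagonWidth_mono hmn
  have h2 := octagonWidth_mono (Nat.add_le_add_right hmn 1)
  obtain ⟨h3, h4, h5⟩ := h
  refine ⟨?_, ?_, ?_⟩ <;> omega

theorem HasLevel.mono {m n : ℕ} {z : GaussianInt} (hmn : m ≤ n) (h : HasLevel m z) :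
    HasLevel n z := by
  obtain ⟨k, hk, h⟩ := h
  exact ⟨k, hk, h.mono hmn le_rfl⟩

theorem exists_two_pow_dvd {z : GaussianInt} (hz : z ≠ 0) :
    ∃ k : ℕ, 2 ^ k ∣ z ∧ ¬ 2 ^ (k + 1) ∣ z := by
  have h2 : ¬ IsUnit (2 : GaussianInt) := by
    rw [← Zsqrtd.norm_eq_one_iff]; decide
  exact ⟨_, (FiniteMultiplicity.of_not_isUnit h2 hz).exists_eq_pow_mul_and_not_dvd.elim
    fun c hc => ⟨c, hc.1⟩, (FiniteMultiplicity.of_not_isUnit h2 hz).not_pow_dvd_of_multiplicity_lt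
      (Nat.lt_succ_self _)⟩

/-- The exponent witnessing a level need not be the exact valuation, only at least it. A larger
exponent gives a smaller octagon, so nothing is lost. -/
theorem HasLevel.inOctagon {n k : ℕ} {z : GaussianInt} (h : HasLevel n z) (hk : 2 ^ k ∣ z) :
    InOctagon n (2 ^ k) z := by
  obtain ⟨l, hl, h⟩ := h
  have hkl : k ≤ l := by
    by_contra! hlt
    exact hl ((pow_dvd_pow _ hlt).trans hk)
  exact h.mono le_rfl (pow_le_pow_right₀ one_le_two hkl)

theorem hasLevel_two_mul_iff {n : ℕ} {z : GaussianInt} :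
    HasLevel (n + 2) (2 * z) ↔ HasLevel n z := by
  have key : ∀ k : ℕ, InOctagon (n + 2) (2 ^ (k + 1)) (2 * z) ↔ InOctagon n (2 ^ k) z := by
    intro k
    have e1 : octagonWidth (n + 2) = 2 * octagonWidth n := rfl
    have e2 : octagonWidth (n + 2 + 1) = 2 * octagonWidth (n + 1) := rfl
    have e3 : (2 : GaussianInt) * z = ⟨2 * z.re, 2 * z.im⟩ := by
      rw [two_mul, two_mul, two_mul]; rfl
    simp only [InOctagon, e1, e2, e3, abs_mul, abs_two, pow_succ]
    constructor <;> rintro ⟨h1, h2, h3⟩ <;> refine ⟨?_, ?_, ?_⟩ <;> omega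
  have key2 : ∀ k : ℕ, 2 ^ (k + 1 + 1) ∣ 2 * z ↔ 2 ^ (k + 1) ∣ z := by
    intro k
    rw [pow_succ' _ (k + 1)]
    exact mul_dvd_mul_iff_left two_ne_zero
  constructor
  · rintro ⟨_ | k, hk, h⟩
    · simp at hk
    · exact ⟨k, by rwa [key2] at hk, (key k).1 h⟩
  · rintro ⟨k, hk, h⟩
    exact ⟨k + 1, by rwa [key2], (key k).2 h⟩

theorem HasLevel.two_le {n : ℕ} {z : GaussianInt} (h : HasLevel n (2 * z)) : 2 ≤ n := by
  by_contra! hn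
  have hz : z ≠ 0 := right_ne_zero_of_mul h.ne_zero
  have h1 := (h.inOctagon (k := 1) (by simp)).mono (show n ≤ 1 by omega) le_rfl
  obtain ⟨h1, h2, -⟩ := h1
  refine h.ne_zero (Zsqrtd.ext ?_ ?_)
  · exact abs_nonpos_iff.1 (h1.trans (by decide))
  · exact abs_nonpos_iff.1 (h2.trans (by decide))

end GaussianInt

/-! ### Size of remainders r with r/b in the centred unit square. -/

theorem two_mul_abs_le_of_near {x y c d N : ℤ} (hN : N = x ^ 2 + y ^ 2) (hN0 : 0 < N)
    (h1 : 2 * |c * x + d * y| ≤ N) (h2 : 2 * |d * x - c * y| ≤ N) :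
    2 * |c| ≤ |x| + |y| := by
  have e : N * c = (c * x + d * y) * x - (d * x - c * y) * y := by rw [hN]; ring
  have h3 : N * |c| ≤ |c * x + d * y| * |x| + |d * x - c * y| * |y| := by
    have : N * |c| = |N * c| := by rw [abs_mul, abs_of_pos hN0]
    rw [this, e, ← abs_mul, ← abs_mul]
    exact abs_sub _ _
  have h4 := mul_le_mul_of_nonneg_right h1 (abs_nonneg x)
  have h5 := mul_le_mul_of_nonneg_right h2 (abs_nonneg y)
  refine le_of_mul_le_mul_left ?_ hN0
  linarith

/-- With r/b = (P + Qi)/N, the sum N(c + d) is P(x + y) + Q(x - y) with nonnegative weights, so P, Q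
≤ N/2 bounds it by N x. -/
theorem abs_add_le_of_near {x y c d N : ℤ} (hN : N = x ^ 2 + y ^ 2) (hN0 : 0 < N)
    (hy : 0 ≤ y) (hyx : y ≤ x)
    (h1 : 2 * |c * x + d * y| ≤ N) (h2 : 2 * |d * x - c * y| ≤ N) : c + d ≤ x := by
  have e : N * (c + d) = (c * x + d * y) * (x + y) + (d * x - c * y) * (x - y) := by rw [hN]; ring
  have h4 := mul_le_mul_of_nonneg_right ((mul_le_mul_of_nonneg_left (le_abs_self _) zero_le_two).trans h1)
    (show 0 ≤ x + y by omega)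
  have h5 := mul_le_mul_of_nonneg_right ((mul_le_mul_of_nonneg_left (le_abs_self _) zero_le_two).trans h2)
    (show 0 ≤ x - y by omega)
  refine le_of_mul_le_mul_left ?_ hN0
  linarith

/-- Both weights x + y and x - y are now positive, so equality forces r/b to be the corner (1 + i)/2
of the square. -/
theorem two_mul_eq_sub_of_near {x y c d N : ℤ} (hN : N = x ^ 2 + y ^ 2) (hN0 : 0 < N)
    (hy : 0 ≤ y) (hyx : y < x)
    (h1 : 2 * |c * x + d * y| ≤ N) (h2 : 2 * |d * x - c * y| ≤ N) (h : c + d = x) :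
    2 * c = x - y := by
  have e : N * (c + d) = (c * x + d * y) * (x + y) + (d * x - c * y) * (x - y) := by rw [hN]; ring
  have e' : N * c = (c * x + d * y) * x - (d * x - c * y) * y := by rw [hN]; ring
  have h3 := (mul_le_mul_of_nonneg_left (le_abs_self (c * x + d * y)) zero_le_two).trans h1
  have h3' := (mul_le_mul_of_nonneg_left (le_abs_self (d * x - c * y)) zero_le_two).trans h2
  generalize c * x + d * y = P at *
  generalize d * x - c * y = Q at *
  have h6 : (N - 2 * P) * (x + y) + (N - 2 * Q) * (x - y) = 0 := by rw [h] at e; linarith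
  have h4 := mul_nonneg (sub_nonneg.2 h3) (show 0 ≤ x + y by omega)
  have h5 := mul_nonneg (sub_nonneg.2 h3') (show 0 ≤ x - y by omega)
  have h7 : (N - 2 * P) * (x + y) = 0 := by omega
  have h8 : (N - 2 * Q) * (x - y) = 0 := by omega
  have h9 : N = 2 * P := by
    rcases mul_eq_zero.1 h7 with h | h <;> omega
  have h10 : N = 2 * Q := by
    rcases mul_eq_zero.1 h8 with h | h <;> omega
  refine mul_left_cancel₀ hN0.ne' ?_
  calc N * (2 * c) = (2 * P) * x - (2 * Q) * y := by linarith
    _ = N * (x - y) := by rw [← h9, ← h10]; ring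

namespace GaussianInt

/-- `r / b` lies in the unit square centred at the origin. -/
def Near (b r : GaussianInt) : Prop :=
  2 * |r.re * b.re + r.im * b.im| ≤ b.re ^ 2 + b.im ^ 2 ∧
    2 * |r.im * b.re - r.re * b.im| ≤ b.re ^ 2 + b.im ^ 2

theorem Near.I_mul_left {b r : GaussianInt} (h : Near b r) : Near (I * b) r := by
  obtain ⟨h1, h2⟩ := h
  refine ⟨?_, ?_⟩ <;> simp only [I_mul_re, I_mul_im]
  · rw [show (-b.im) ^ 2 + b.re ^ 2 = b.re ^ 2 + b.im ^ 2 by ring]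
    convert h2 using 2; ring_nf
  · rw [← abs_neg, show (-b.im) ^ 2 + b.re ^ 2 = b.re ^ 2 + b.im ^ 2 by ring]
    convert h1 using 2; ring_nf

theorem Near.I_mul_right {b r : GaussianInt} (h : Near b r) : Near b (I * r) := by
  obtain ⟨h1, h2⟩ := h
  refine ⟨?_, ?_⟩ <;> simp only [I_mul_re, I_mul_im]
  · rw [← abs_neg]
    convert h2 using 2; ring_nf
  · convert h1 using 2; ring_nf

theorem Near.star {b r : GaussianInt} (h : Near b r) : Near (star b) (star r) := by
  obtain ⟨h1, h2⟩ := h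
  refine ⟨?_, ?_⟩ <;> simp only [Zsqrtd.re_star, Zsqrtd.im_star]
  · convert h1 using 2 <;> ring_nf
  · rw [← abs_neg]
    convert h2 using 2 <;> ring_nf

theorem sq_add_sq_pos {b : GaussianInt} (hb : b ≠ 0) : 0 < b.re ^ 2 + b.im ^ 2 := by
  by_contra! h
  refine hb (Zsqrtd.ext ?_ ?_)
  · exact pow_eq_zero_iff two_ne_zero |>.1 (by nlinarith [sq_nonneg b.re, sq_nonneg b.im])
  · exact pow_eq_zero_iff two_ne_zero |>.1 (by nlinarith [sq_nonneg b.re, sq_nonneg b.im])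

theorem Near.bounds {b r : GaussianInt} (hb : b ≠ 0) (hy : 0 ≤ b.im) (hyx : b.im ≤ b.re)
    (h : Near b r) : 2 * |r.re| ≤ b.re + b.im ∧ 2 * |r.im| ≤ b.re + b.im ∧
      |r.re| + |r.im| ≤ b.re ∧
      (|r.re| + |r.im| = b.re → b.im < b.re →
        (2 * r.re = b.re - b.im ∨ 2 * r.re = -(b.re - b.im) ∨
        2 * r.im = b.re - b.im ∨ 2 * r.im = -(b.re - b.im))) := by
  have hN := sq_add_sq_pos hb
  have hx : 0 ≤ b.re := hy.trans hyx
  -- The four rotations of r supply all sign patterns in |re r| + |im r|.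
  have hr1 := h.I_mul_right
  have hr2 := hr1.I_mul_right
  have hr3 := hr2.I_mul_right
  have b1 := two_mul_abs_le_of_near rfl hN h.1 h.2
  have b2 := two_mul_abs_le_of_near rfl hN hr1.1 hr1.2
  have s0 := abs_add_le_of_near rfl hN hy hyx h.1 h.2
  have s1 := abs_add_le_of_near rfl hN hy hyx hr1.1 hr1.2
  have s2 := abs_add_le_of_near rfl hN hy hyx hr2.1 hr2.2
  have s3 := abs_add_le_of_near rfl hN hy hyx hr3.1 hr3.2
  simp only [I_mul_re, I_mul_im, abs_neg, abs_of_nonneg hx, abs_of_nonneg hy] at b1 b2 s0 s1 s2 s3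
  refine ⟨b1, b2, ?_, fun he hlt => ?_⟩
  · rw [abs_add_abs_le_iff]
    omega
  · have t0 := two_mul_eq_sub_of_near rfl hN hy hlt h.1 h.2
    have t1 := two_mul_eq_sub_of_near rfl hN hy hlt hr1.1 hr1.2
    have t2 := two_mul_eq_sub_of_near rfl hN hy hlt hr2.1 hr2.2
    have t3 := two_mul_eq_sub_of_near rfl hN hy hlt hr3.1 hr3.2
    simp only [I_mul_re, I_mul_im] at t0 t1 t2 t3
    rcases abs_cases r.re with h1 | h1 <;> rcases abs_cases r.im with h2 | h2 <;> omega

/-- Supplies the arithmetic for equal valuations in `HasLevel.of_near`: the widths are multiples of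
2^j, so bounds can be rounded. The last alternative isolates the one case where the parity argument
fails. -/
theorem pow_dvd_octagonWidth {N : ℕ} {j : ℕ} (h : 3 * 2 ^ j ≤ octagonWidth (N + 1)) :
    (2 : ℤ) ^ j ∣ octagonWidth N ∧ (2 : ℤ) ^ j ∣ octagonWidth (N + 1) ∧
    2 ^ j < 2 * (octagonWidth (N + 1) - octagonWidth N) ∧
    (2 * (2 : ℤ) ^ j ∣ octagonWidth (N + 1) ∨ octagonWidth N = 2 * 2 ^ j) := by
  have hp : ∀ m k : ℕ, (2 : ℤ) ^ m < 2 * 2 ^ k → (2 : ℤ) ^ m ∣ 2 ^ k := by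
    intro m k h
    rw [← pow_succ'] at h
    exact pow_dvd_pow _ (Nat.lt_succ_iff.1 ((pow_lt_pow_iff_right₀ one_lt_two).1 h))
  obtain ⟨t, ⟨h1, h2, h3⟩ | ⟨h1, h2, h3⟩⟩ := octagonWidth_cases N
  · have hW : (0 : ℤ) < 2 ^ t := by positivity
    have hj := hp j t (by omega)
    have hj' := Int.le_of_dvd hW hj
    rw [h2, h3]
    refine ⟨hj.mul_left _, hj.mul_left _, by omega, .inl ?_⟩
    rw [show (4 : ℤ) * 2 ^ t = 2 * (2 * 2 ^ t) by ring]
    exact mul_dvd_mul_left _ (hj.mul_left _)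
  · have hW : (0 : ℤ) < 2 ^ t := by positivity
    have hj := hp j (t + 1) (by rw [pow_succ]; omega)
    have hj' := Int.le_of_dvd (by positivity) hj
    rw [pow_succ, mul_comm] at hj hj'
    rw [h2, h3]
    refine ⟨?_, ?_, by omega, ?_⟩
    · rw [show (4 : ℤ) * 2 ^ t = 2 * (2 * 2 ^ t) by ring]
      exact hj.mul_left _
    · rw [show (6 : ℤ) * 2 ^ t = 3 * (2 * 2 ^ t) by ring]
      exact hj.mul_left _
    · rcases lt_or_ge j (t + 1) with h | h
      · left
        rw [show (6 : ℤ) * 2 ^ t = 3 * (2 * 2 ^ t) by ring, ← pow_succ', ← pow_succ']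
        exact (pow_dvd_pow _ h).mul_left _
      · right
        have : (2 : ℤ) ^ (t + 1) ≤ 2 ^ j := pow_le_pow_right₀ one_le_two h
        rw [pow_succ] at this
        omega

/-- A nearest remainder that is at most as divisible by `2` as the divisor has lower level than
the divisor. -/
theorem HasLevel.of_near {N j k : ℕ} {b : GaussianInt} (hb : HasLevel (N + 1) b)
    (hj : 2 ^ j ∣ b) (hj' : ¬ 2 ^ (j + 1) ∣ b) (hkj : k ≤ j) {r : GaussianInt}
    (hk : 2 ^ k ∣ r) (hk' : ¬ 2 ^ (k + 1) ∣ r) (h : Near b r) : HasLevel N r := by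
  refine ⟨k, hk', ?_⟩
  have hr : r ≠ 0 := by
    rintro rfl
    exact hk' (dvd_zero _)
  clear hk'
  induction b using symm_induction generalizing r with
  | hI b ih =>
    rw [hasLevel_I_mul_iff, dvd_I_mul_iff, dvd_I_mul_iff] at ih
    exact ih hb hj hj' hk h.I_mul_left hr
  | hstar b ih =>
    rw [hasLevel_star_iff, two_pow_dvd_star_iff, two_pow_dvd_star_iff] at ih
    rw [← inOctagon_star_iff]
    exact ih hb hj hj' (two_pow_dvd_star_iff.2 hk) h.star (star_ne_zero.2 hr)
  | h b hy hyx =>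
    obtain ⟨b1, b2, b3⟩ := hb.inOctagon hj
    obtain ⟨n1, n2, n3, n4⟩ := h.bounds hb.ne_zero hy hyx
    have hx : 0 ≤ b.re := hy.trans hyx
    have e : octagonWidth (N + 1 + 1) = 2 * octagonWidth N := rfl
    rw [abs_of_nonneg hx, abs_of_nonneg hy] at *
    rw [e] at b3
    have hJ : (0 : ℤ) < 2 ^ j := by positivity
    rcases hkj.lt_or_eq with hlt | rfl
    -- A strictly smaller valuation of r gives enough slack without any rounding.
    · have : 2 * (2 : ℤ) ^ k ≤ 2 ^ j := by
        rw [← pow_succ']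
        exact pow_le_pow_right₀ one_le_two hlt
      refine ⟨?_, ?_, ?_⟩ <;> omega
    · rw [two_pow_dvd_iff] at hj hk hj'
      have hJx : (2 : ℤ) ^ k ≤ b.re := by
        refine Int.le_of_dvd (hx.lt_of_ne' ?_) hj.1
        intro h0
        exact hb.ne_zero (Zsqrtd.ext h0 (le_antisymm (hyx.trans h0.le) hy))
      obtain ⟨d1, d2, d3, d4⟩ := pow_dvd_octagonWidth (N := N) (j := k) (by omega)
      have c1 := (dvd_abs _ _).2 hk.1
      have c2 := (dvd_abs _ _).2 hk.2
      have key : ∀ a : ℤ, 2 ^ k ∣ a → a < octagonWidth N - 2 ^ k →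
          a ≤ octagonWidth N - 2 * 2 ^ k := by
        intro a ha h
        have := Int.add_le_of_dvd_of_lt ha (dvd_sub d1 dvd_rfl) h
        omega
      refine ⟨key _ c1 (by omega), key _ c2 (by omega), ?_⟩
      -- After rounding to multiples of 2^k, the sum bound can fail only when |re r| + |im r| = re b
      -- = w_{N+1} - 2·2^k, which puts r/b at a corner of the square.
      by_contra! hcon
      have hs : |r.re| + |r.im| = octagonWidth (N + 1) - 2 * 2 ^ k := by
        by_contra hne
        have := Int.add_le_of_dvd_of_lt (dvd_add c1 c2)
          (dvd_sub d2 (Dvd.intro_left 2 rfl))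
          (show |r.re| + |r.im| < octagonWidth (N + 1) - 2 * 2 ^ k by omega)
        omega
      have hre : |r.re| + |r.im| = b.re := by omega
      rcases d4 with d4 | d4
      -- At the corner, re b - im b is twice a coordinate of r up to sign; hence 2^(k+1) would
      -- divide b.
      · have hbx : 2 * 2 ^ k ∣ b.re := by
          rw [← hre, hs]
          exact dvd_sub d4 dvd_rfl
        have hbxy : 2 * 2 ^ k ∣ b.re - b.im := by
          rcases n4 hre (by omega) with h | h | h | h
          · exact h ▸ mul_dvd_mul_left _ hk.1
          · exact (dvd_neg.1 (h ▸ mul_dvd_mul_left _ hk.1))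
          · exact h ▸ mul_dvd_mul_left _ hk.2
          · exact (dvd_neg.1 (h ▸ mul_dvd_mul_left _ hk.2))
        rw [pow_succ'] at hj'
        exact hj' ⟨hbx, (dvd_sub_right hbx).1 hbxy⟩
      -- Here w_N = 2·2^k, so the coordinate bounds leave only r = 0.
      · have k1 := key _ c1 (by omega)
        have k2 := key _ c2 (by omega)
        refine hr (Zsqrtd.ext ?_ ?_)
        · exact abs_nonpos_iff.1 (by omega)
        · exact abs_nonpos_iff.1 (by omega)

theorem Near.eq_zero {b r : GaussianInt} (hb : HasLevel 0 b) (h : Near b r) : r = 0 := by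
  induction b using symm_induction generalizing r with
  | hI b ih => exact ih (hasLevel_I_mul_iff.2 hb) h.I_mul_left
  | hstar b ih => simpa using ih (hasLevel_star_iff.2 hb) h.star
  | h b hy hyx =>
    obtain ⟨b1, b2, b3⟩ := hb.inOctagon (k := 0) (by simp)
    obtain ⟨n1, n2, -⟩ := h.bounds hb.ne_zero hy hyx
    rw [abs_of_nonneg (hy.trans hyx), abs_of_nonneg hy] at b3
    simp only [octagonWidth] at b3
    refine Zsqrtd.ext ?_ ?_
    · exact abs_nonpos_iff.1 (by omega)
    · exact abs_nonpos_iff.1 (by omega)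

end GaussianInt

/-! ### Gauss remainders, and division that lowers the level. -/

/-- Only the rounding error of at most 1/2 matters; the treatment of half-integers plays no role. -/
theorem two_mul_abs_sub_nint_mul_le (v : ℤ) {N : ℤ} (hN : 0 < N) :
    2 * |v - nint ((v : ℚ) / (N : ℚ)) * N| ≤ N := by
  have hN' : (0 : ℚ) < N := by exact_mod_cast hN
  have key : ∀ x : ℚ, 2 * |x - nint x| ≤ 1 := by
    intro x
    have h1 := Int.floor_le x
    have h2 := Int.lt_floor_add_one x
    have h3 := Int.le_ceil x
    have h4 := Int.ceil_le_floor_add_one x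
    have h4' : (⌈x⌉ : ℚ) ≤ ⌊x⌋ + 1 := by exact_mod_cast h4
    unfold nint
    split_ifs with h
    · rw [abs_of_nonneg (by linarith)]; linarith
    · rw [abs_of_nonpos (by linarith)]; linarith
  have h := mul_le_mul_of_nonneg_right (key ((v : ℚ) / N)) hN'.le
  generalize nint ((v : ℚ) / N) = m at *
  have e : ((v : ℚ) - m * N) = ((v : ℚ) / N - m) * N := by
    field_simp
  have h' : 2 * |(v : ℚ) - m * N| ≤ N := by
    rw [e, abs_mul, abs_of_pos hN']
    linarith
  exact_mod_cast h'

namespace GaussianInt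

theorem near_gaussRemainder (a : GaussianInt) {b : GaussianInt} (hb : b ≠ 0) :
    Near b (gaussRemainder a b) := by
  have hN : b.norm = b.re ^ 2 + b.im ^ 2 := by rw [Zsqrtd.norm_def]; ring
  have hN0 : 0 < b.norm := hN ▸ sq_add_sq_pos hb
  have h1 := two_mul_abs_sub_nint_mul_le (a * star b).re hN0
  have h2 := two_mul_abs_sub_nint_mul_le (a * star b).im hN0
  have e : gaussQuotient a b = ⟨nint (((a * star b).re : ℚ) / (b.norm : ℚ)),
    nint (((a * star b).im : ℚ) / (b.norm : ℚ))⟩ := rfl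
  unfold Near gaussRemainder
  rw [e]
  generalize nint (((a * star b).re : ℚ) / (b.norm : ℚ)) = p at *
  generalize nint (((a * star b).im : ℚ) / (b.norm : ℚ)) = q at *
  rw [hN] at h1 h2
  simp only [Zsqrtd.re_mul, Zsqrtd.im_mul, Zsqrtd.re_star, Zsqrtd.im_star, Zsqrtd.re_sub,
    Zsqrtd.im_sub] at *
  constructor
  · convert h1 using 3; ring
  · convert h2 using 3; ring

/-- When r is more divisible by 2 than b, r itself may have too high a level. Subtracting a unit
multiple of b destroys the divisibility by 2, so only the largest octagon, K = 1, has to be reached.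
-/
theorem HasLevel.exists_sub_of_near {N : ℕ} {b r : GaussianInt} (hb : HasLevel (N + 1) b)
    (hb2 : ¬ 2 ∣ b) (hr2 : 2 ∣ r) (hr0 : r ≠ 0) (h : Near b r) :
    ∃ q, HasLevel N (r - q * b) := by
  induction b using symm_induction generalizing r with
  | hI b ih =>
    obtain ⟨q, hq⟩ := ih (hasLevel_I_mul_iff.2 hb) (by rwa [dvd_I_mul_iff]) hr2 hr0 h.I_mul_left
    exact ⟨q * I, by rwa [mul_assoc]⟩
  | hstar b ih =>
    have h2 : ∀ z : GaussianInt, 2 ∣ star z ↔ 2 ∣ z := fun z => by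
      simpa using two_pow_dvd_star_iff (k := 1) (z := z)
    obtain ⟨q, hq⟩ := ih (hasLevel_star_iff.2 hb) (by rwa [h2]) ((h2 r).2 hr2)
      (star_ne_zero.2 hr0) h.star
    refine ⟨star q, ?_⟩
    rw [← hasLevel_star_iff]
    simpa [mul_comm] using hq
  | h b hy hyx =>
  induction r using rotation_induction with
  | hI r ih =>
    obtain ⟨q, hq⟩ := ih (dvd_I_mul_iff.2 hr2) (mul_ne_zero (by decide) hr0) h.I_mul_right
    refine ⟨-I * q, ?_⟩
    rw [← hasLevel_I_mul_iff]
    convert hq using 1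
    linear_combination (q * b) * I_mul_I
  | h r hcd =>
  obtain ⟨k, hk, hk'⟩ := exists_two_pow_dvd hr0
  by_cases hO : InOctagon N (2 ^ k) r
  · exact ⟨0, k, by simpa using hk', by simpa using hO⟩
  have hd : 0 ≤ r.im := (abs_nonneg _).trans hcd
  have hd0 : 0 < r.im := by
    refine hd.lt_of_ne' fun h0 => hr0 (Zsqrtd.ext ?_ h0)
    exact abs_nonpos_iff.1 (hcd.trans h0.le)
  obtain ⟨b1, -, b3⟩ := hb.inOctagon (k := 0) (by simp)
  obtain ⟨n1, n2, n3, -⟩ := h.bounds hb.ne_zero hy hyx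
  have e : octagonWidth (N + 1 + 1) = 2 * octagonWidth N := rfl
  have hxy : ¬ (2 ∣ b.re ∧ 2 ∣ b.im) := by
    simpa using (two_pow_dvd_iff (k := 1)).not.1 (by simpa using hb2)
  rw [abs_of_nonneg (hy.trans hyx)] at b1 b3
  rw [abs_of_nonneg hy, e] at b3
  rw [abs_of_nonneg hd] at n2 n3
  unfold InOctagon at hO
  rw [abs_of_nonneg hd] at hO
  have hk0 : k ≠ 0 := by
    rintro rfl
    exact hk' (by simpa using hr2)
  obtain ⟨hkc, hkd⟩ := two_pow_dvd_iff.1 hk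
  have hKd := Int.le_of_dvd hd0 hkd
  suffices H : (|r.re - b.re| ≤ octagonWidth N - 2 ∧ |r.im - b.im| ≤ octagonWidth N - 2 ∧
      |r.re - b.re| + |r.im - b.im| ≤ octagonWidth (N + 1) - 3) ∨
      (|r.re + b.im| ≤ octagonWidth N - 2 ∧ |r.im - b.re| ≤ octagonWidth N - 2 ∧
        |r.re + b.im| + |r.im - b.re| ≤ octagonWidth (N + 1) - 3) by
    rcases H with H | H
    · refine ⟨1, 0, ?_, ?_⟩
      · simpa [dvd_sub_right hr2] using hb2
      · simpa [InOctagon] using H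
    · refine ⟨I, 0, ?_, ?_⟩
      · simpa [dvd_sub_right hr2, dvd_I_mul_iff] using hb2
      · simpa only [InOctagon, Zsqrtd.re_sub, Zsqrtd.im_sub, I_mul_re, I_mul_im, pow_zero, mul_one,
          sub_neg_eq_add] using H
  have hw : ∃ t : ℕ, (octagonWidth N = 3 * 2 ^ t ∧ octagonWidth (N + 1) = 4 * 2 ^ t) ∨
      (octagonWidth N = 4 * 2 ^ t ∧ octagonWidth (N + 1) = 6 * 2 ^ t) :=
    (octagonWidth_cases N).imp fun t => Or.imp And.right And.right
  obtain ⟨t, hw⟩ := hw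
  have hW : (0 : ℤ) < 2 ^ t := by positivity
  -- From 2^k ≤ im r < w_N ≤ 4·2^t.
  have hkt : k < t + 2 := by
    refine (pow_lt_pow_iff_right₀ (one_lt_two (α := ℤ))).1 ?_
    rw [pow_add]
    omega
  rcases Nat.lt_or_ge k (t + 1) with hkt' | hkt'
  · exact octagon_translate_of_dvd hw (dvd_pow_self 2 hk0) (by positivity) (pow_dvd_pow _ (by omega))
      hkc hkd hy hyx hxy (by omega) (by omega) hcd (by omega) (by omega) (by omega) hW
  · have hkt2 : k = t + 1 := by omega
    exact octagon_translate_of_eq_two_mul hw (by rw [hkt2, pow_succ']) hkc hkd hy hyx hxy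
      (by omega) (by omega) hd0 hcd
      (by omega) (by omega)

theorem HasLevel.of_near_of_not_dvd {N : ℕ} {b r : GaussianInt} (hb : HasLevel (N + 1) b)
    (hr : ¬ 2 ∣ r) (h : Near b r) : HasLevel N r := by
  obtain ⟨j, hj, hj'⟩ := exists_two_pow_dvd hb.ne_zero
  exact hb.of_near hj hj' (Nat.zero_le j) (by simp) (by simpa using hr) h

/-- If 2 divides both the Gauss remainder and b, it divides a too, and halving a and b lowers the
level of b by two. Otherwise the Gauss remainder works, possibly after a correction by a unit
multiple of b. -/
theorem HasLevel.exists_sub {n : ℕ} {b : GaussianInt} (hb : HasLevel n b) (a : GaussianInt) :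
    ∃ q, a - q * b = 0 ∨ ∃ m < n, HasLevel m (a - q * b) := by
  induction n using Nat.strong_induction_on generalizing a b with
  | h n ih =>
  have hnear := near_gaussRemainder a hb.ne_zero
  rcases n with _ | N
  · exact ⟨_, .inl (hnear.eq_zero hb)⟩
  by_cases hr2 : 2 ∣ gaussRemainder a b
  · by_cases hb2 : 2 ∣ b
    · have ha2 : 2 ∣ a := (dvd_sub_left (hb2.mul_left _)).1 hr2
      obtain ⟨b, rfl⟩ := hb2
      obtain ⟨a, rfl⟩ := ha2
      have hN := hb.two_le
      obtain ⟨M, hM⟩ : ∃ M, N + 1 = M + 2 := ⟨N - 1, by omega⟩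
      rw [hM] at hb ⊢
      obtain ⟨q, hq⟩ := ih M (by omega) (hasLevel_two_mul_iff.1 hb) a
      have e : 2 * a - q * (2 * b) = 2 * (a - q * b) := by ring
      refine ⟨q, ?_⟩
      rw [e]
      rcases hq with hq | ⟨m, hm, hq⟩
      · exact .inl (by rw [hq, mul_zero])
      · exact .inr ⟨m + 2, by omega, hasLevel_two_mul_iff.2 hq⟩
    · by_cases hr0 : gaussRemainder a b = 0
      · exact ⟨_, .inl hr0⟩
      · obtain ⟨q, hq⟩ := hb.exists_sub_of_near hb2 hr2 hr0 hnear
        refine ⟨gaussQuotient a b + q, .inr ⟨N, by omega, ?_⟩⟩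
        convert hq using 1
        rw [gaussRemainder]
        ring
  · exact ⟨_, .inr ⟨N, by omega, hb.of_near_of_not_dvd hr2 hnear⟩⟩

end GaussianInt

/-! ### Lower bound: test elements and passage to divisors. -/

namespace GaussianInt

theorem two_pow_le_max_of_dvd {k : ℕ} {z : GaussianInt} (hz : z ≠ 0) (h : 2 ^ k ∣ z) :
    (2 : ℤ) ^ k ≤ |z.re| ∨ (2 : ℤ) ^ k ≤ |z.im| := by
  rw [two_pow_dvd_iff] at h
  by_contra! hlt
  refine hz (Zsqrtd.ext ?_ ?_)
  · exact Int.eq_zero_of_abs_lt_dvd h.1 hlt.1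
  · exact Int.eq_zero_of_abs_lt_dvd h.2 hlt.2

theorem exists_hasLevel_sub (n : ℕ) :
    ∃ g, HasLevel n g ∧ ∀ m < n, ∀ x, HasLevel m x → HasLevel n (g - x) := by
  rcases n with _ | N
  · exact ⟨1, ⟨0, by rw [two_pow_dvd_iff]; decide, by unfold InOctagon; decide⟩, by simp⟩
  obtain ⟨t, ⟨-, h2, h3⟩ | ⟨-, h2, h3⟩⟩ := octagonWidth_cases N
  · have hW : (0 : ℤ) < 2 ^ t := by positivity
    have h4 : octagonWidth (N + 1 + 1) = 2 * octagonWidth N := rfl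
    -- Up to a unit this is (1+i)^(2t+1); in the other parity, 2^(t+1) is (1+i)^(2t+2).
    refine ⟨⟨2 ^ t, 2 ^ t⟩, ⟨t, ?_, ?_⟩, fun m hm x hx => ?_⟩
    · rw [two_pow_dvd_iff, pow_succ]
      intro h
      have := Int.le_of_dvd hW h.1
      omega
    · simp only [InOctagon, h2, h3, h4, abs_of_pos hW]
      omega
    · obtain ⟨k, hk, hk'⟩ := exists_two_pow_dvd hx.ne_zero
      have hmax := two_pow_le_max_of_dvd hx.ne_zero hk
      obtain ⟨b1, b2, b3⟩ := (hx.mono (Nat.le_of_lt_succ hm)).inOctagon hk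
      have a1 := abs_sub (2 ^ t) x.re
      have a2 := abs_sub (2 ^ t) x.im
      rw [abs_of_pos hW] at a1 a2
      refine ⟨k, ?_, ?_⟩
      · have hkt : k < t + 1 := by
          refine (pow_lt_pow_iff_right₀ (one_lt_two (α := ℤ))).1 ?_
          rw [pow_succ]
          omega
        rcases (Nat.le_of_lt_succ hkt).lt_or_eq with hlt | rfl
        · refine fun h => hk' ((dvd_sub_right ?_).1 h)
          rw [two_pow_dvd_iff]
          exact ⟨pow_dvd_pow _ hlt, pow_dvd_pow _ hlt⟩
        -- Equal valuations could cancel, but that needs both |re x| and |im x| to be at least 2^k,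
        -- while the octagon bounds their sum by 2^k.
        · rw [two_pow_dvd_iff, Zsqrtd.re_sub, Zsqrtd.im_sub]
          rintro ⟨h5, h6⟩
          have key : ∀ a : ℤ, |a| ≤ 2 ^ k → 2 ^ (k + 1) ∣ 2 ^ k - a → 2 ^ k ≤ |a| := by
            intro a ha hdvd
            rcases (le_abs_self a |>.trans ha).eq_or_lt with h | h
            · rw [← h]; exact le_abs_self a
            · have := Int.le_of_dvd (by omega) hdvd
              rw [pow_succ] at this
              have := neg_le_abs a
              omega
          have := key _ (by omega) h5
          have := key _ (by omega) h6
          omega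
      · simp only [InOctagon, Zsqrtd.re_sub, Zsqrtd.im_sub, h4]
        omega
  · have hW : (0 : ℤ) < 2 ^ t := by positivity
    have hW2 : (0 : ℤ) < 2 ^ (t + 1) := by positivity
    have h4 : octagonWidth (N + 1 + 1) = 2 * octagonWidth N := rfl
    refine ⟨⟨2 ^ (t + 1), 0⟩, ⟨t + 1, ?_, ?_⟩, fun m hm x hx => ?_⟩
    · rw [two_pow_dvd_iff]
      intro h
      have := Int.le_of_dvd (by positivity) h.1
      simp only [pow_succ] at this
      omega
    · simp only [InOctagon, h2, h3, h4, abs_zero]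
      rw [abs_of_pos hW2, pow_succ]
      omega
    · obtain ⟨k, hk, hk'⟩ := exists_two_pow_dvd hx.ne_zero
      have hmax := two_pow_le_max_of_dvd hx.ne_zero hk
      obtain ⟨b1, b2, b3⟩ := (hx.mono (Nat.le_of_lt_succ hm)).inOctagon hk
      have a1 := abs_sub (2 ^ (t + 1)) x.re
      rw [abs_of_pos hW2] at a1
      refine ⟨k, ?_, ?_⟩
      · have hkt : k < t + 1 := by
          refine (pow_lt_pow_iff_right₀ (one_lt_two (α := ℤ))).1 ?_
          rw [pow_succ]
          omega
        refine fun h => hk' ((dvd_sub_right ?_).1 h)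
        rw [two_pow_dvd_iff]
        exact ⟨pow_dvd_pow _ (by omega), dvd_zero _⟩
      · simp only [InOctagon, Zsqrtd.re_sub, Zsqrtd.im_sub, h4, zero_sub, abs_neg]
        rw [pow_succ] at *
        omega

/-- The coordinates of (1+i)x are re x ∓ im x, so bounding them bounds |re x| + |im x|. -/
theorem HasLevel.of_one_add_I {n : ℕ} {x : GaussianInt} (h : HasLevel n ((1 + I) * x)) :
    HasLevel n x := by
  have hx := right_ne_zero_of_mul h.ne_zero
  obtain ⟨k, hk, hk'⟩ := exists_two_pow_dvd hx
  obtain ⟨b1, b2, b3⟩ := h.inOctagon (hk.mul_left _)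
  have hre : ((1 + I) * x).re = x.re - x.im := by
    rw [add_mul, one_mul, Zsqrtd.re_add, I_mul_re, sub_eq_add_neg]
  have him : ((1 + I) * x).im = x.re + x.im := by
    rw [add_mul, one_mul, Zsqrtd.im_add, I_mul_im, add_comm]
  rw [hre] at b1 b3
  rw [him] at b2 b3
  refine ⟨k, hk', ?_⟩
  have hK : (0 : ℤ) < 2 ^ k := by positivity
  have hsum : |x.re| + |x.im| ≤ octagonWidth n - 2 * 2 ^ k := by
    rw [abs_add_abs_le_iff]
    rw [abs_le] at b1 b2
    omega
  have h1 := abs_nonneg x.re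
  have h2 := abs_nonneg x.im
  have hmax := two_pow_le_max_of_dvd hx hk
  refine ⟨by omega, by omega, ?_⟩
  obtain ⟨t, ⟨-, w1, w2⟩ | ⟨-, w1, w2⟩⟩ := octagonWidth_cases n
  · have hkt : k < t + 1 := by
      refine (pow_lt_pow_iff_right₀ (one_lt_two (α := ℤ))).1 ?_
      rw [pow_succ]
      omega
    have : (2 : ℤ) ^ k ≤ 2 ^ t := pow_le_pow_right₀ one_le_two (by omega)
    omega
  · omega

theorem HasLevel.of_two_mul {n : ℕ} {x : GaussianInt} (h : HasLevel n (2 * x)) : HasLevel n x := by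
  obtain ⟨m, rfl⟩ : ∃ m, n = m + 2 := ⟨n - 2, by have := h.two_le; omega⟩
  exact (hasLevel_two_mul_iff.1 h).mono (by omega)

theorem sq_add_sq_lt_of_octagon {a b W : ℤ} (hW : 0 < W) (ha0 : 0 ≤ a) (hb0 : 0 ≤ b)
    (ha : a < 3 * W) (hb : b < 3 * W) (hab : a + b < 4 * W) : a ^ 2 + b ^ 2 < 10 * W ^ 2 := by
  rcases le_total a W with h | h
  · nlinarith
  · rcases le_total b W with h' | h'
    · nlinarith
    · nlinarith [mul_nonneg (sub_nonneg.2 h) (sub_nonneg.2 h')]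

theorem sq_add_sq_lt_of_octagon' {a b W : ℤ} (hW : 0 < W) (ha0 : 0 ≤ a) (hb0 : 0 ≤ b)
    (ha : a < 4 * W) (hb : b < 4 * W) (hab : a + b < 6 * W) : a ^ 2 + b ^ 2 < 20 * W ^ 2 := by
  rcases le_total a (2 * W) with h | h
  · nlinarith
  · rcases le_total b (2 * W) with h' | h'
    · nlinarith
    · nlinarith [mul_nonneg (sub_nonneg.2 h) (sub_nonneg.2 h')]

theorem lt_of_sq_add_sq_lt {c d W : ℤ} (hW : 0 < W) (h : c ^ 2 + d ^ 2 < 2 * W ^ 2) :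
    c + d < 2 * W ∧ 2 * c < 3 * W ∧ 2 * d < 3 * W := by
  have h1 := sq_nonneg (c - d)
  have h2 := sq_nonneg c
  have h3 := sq_nonneg d
  have h4 : 0 < W ^ 2 := by positivity
  refine ⟨?_, ?_, ?_⟩ <;> refine lt_of_pow_lt_pow_left₀ 2 (by positivity) ?_ <;> linarith

theorem lt_of_sq_add_sq_lt' {c d W : ℤ} (hW : 0 < W) (h : c ^ 2 + d ^ 2 < 4 * W ^ 2) :
    c + d < 3 * W ∧ c < 2 * W ∧ d < 2 * W := by
  have h1 := sq_nonneg (c - d)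
  have h2 := sq_nonneg c
  have h3 := sq_nonneg d
  have h4 : 0 < W ^ 2 := by positivity
  refine ⟨?_, ?_, ?_⟩ <;> refine lt_of_pow_lt_pow_left₀ 2 (by positivity) ?_ <;> linarith

/-- Compares norms: the octagon vertices (3W, W) and (4W, 2W) have norms 10W² and 20W², so a factor
of norm at least 5 leaves x in a disc of squared radius 2W² or 4W². The disc, with divisibility by
2^k, fits the octagon condition. -/
theorem HasLevel.of_mul_of_five_le {n : ℕ} {x y : GaussianInt} (h : HasLevel n (y * x))
    (hy : 5 ≤ y.re ^ 2 + y.im ^ 2) : HasLevel n x := by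
  have hx := right_ne_zero_of_mul h.ne_zero
  have hxN := sq_add_sq_pos hx
  have hmul : (y.re ^ 2 + y.im ^ 2) * (x.re ^ 2 + x.im ^ 2) =
      |(y * x).re| ^ 2 + |(y * x).im| ^ 2 := by
    rw [sq_abs, sq_abs, Zsqrtd.re_mul, Zsqrtd.im_mul]
    ring
  obtain ⟨l, -, b1, b2, b3⟩ := h
  have h5 := mul_le_mul_of_nonneg_right hy hxN.le
  have hl : (0 : ℤ) < 2 ^ l := by positivity
  obtain ⟨k, hk, hk'⟩ := exists_two_pow_dvd hx
  have hmax := two_pow_le_max_of_dvd hx hk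
  have hK : (0 : ℤ) < 2 ^ k := by positivity
  refine ⟨k, hk', ?_⟩
  rw [two_pow_dvd_iff, ← dvd_abs, ← dvd_abs _ x.im] at hk
  rw [← sq_abs x.re, ← sq_abs x.im] at hmul hxN h5
  have c0 := abs_nonneg x.re
  have d0 := abs_nonneg x.im
  unfold InOctagon
  generalize |x.re| = c at *
  generalize |x.im| = d at *
  have p0 := abs_nonneg (y * x).re
  have q0 := abs_nonneg (y * x).im
  generalize |(y * x).re| = p at *
  generalize |(y * x).im| = q at *
  obtain ⟨t, ⟨-, w1, w2⟩ | ⟨-, w1, w2⟩⟩ := octagonWidth_cases n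
  · rw [w1] at b1 b2 ⊢
    rw [w2] at b3 ⊢
    have hW : (0 : ℤ) < 2 ^ t := by positivity
    have hpq := sq_add_sq_lt_of_octagon hW p0 q0 (by omega) (by omega) (by omega)
    have hlt : c ^ 2 + d ^ 2 < 2 * (2 ^ t) ^ 2 := by linarith
    obtain ⟨hcd, hc, hd⟩ := lt_of_sq_add_sq_lt hW hlt
    have hkt : k < t + 1 := by
      refine (pow_lt_pow_iff_right₀ (one_lt_two (α := ℤ))).1 ?_
      rw [pow_succ]
      omega
    rcases (Nat.le_of_lt_succ hkt).lt_or_eq with hlt' | rfl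
    · have : 2 * (2 : ℤ) ^ k ≤ 2 ^ t := by
        rw [← pow_succ']
        exact pow_le_pow_right₀ one_le_two hlt'
      omega
    · have := Int.add_le_of_dvd_of_lt (dvd_add hk.1 hk.2) (Dvd.intro_left 2 rfl) hcd
      omega
  · rw [w1] at b1 b2 ⊢
    rw [w2] at b3 ⊢
    have hW : (0 : ℤ) < 2 ^ t := by positivity
    have hpq := sq_add_sq_lt_of_octagon' hW p0 q0 (by omega) (by omega) (by omega)
    have hlt : c ^ 2 + d ^ 2 < 4 * (2 ^ t) ^ 2 := by linarith
    obtain ⟨hcd, hc, hd⟩ := lt_of_sq_add_sq_lt' hW hlt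
    have hkt : k < t + 1 := by
      refine (pow_lt_pow_iff_right₀ (one_lt_two (α := ℤ))).1 ?_
      rw [pow_succ]
      omega
    have : (2 : ℤ) ^ k ≤ 2 ^ t := pow_le_pow_right₀ one_le_two (by omega)
    omega

theorem HasLevel.of_mul {n : ℕ} {x y : GaussianInt} (h : HasLevel n (y * x)) : HasLevel n x := by
  by_cases hy : 5 ≤ y.re ^ 2 + y.im ^ 2
  · exact h.of_mul_of_five_le hy
  induction y using symm_induction generalizing x with
  | hI y ih =>
    refine ih (by rwa [mul_assoc, hasLevel_I_mul_iff]) ?_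
    rwa [I_mul_re, I_mul_im, neg_sq, add_comm]
  | hstar y ih =>
    rw [← hasLevel_star_iff]
    refine ih ?_ (by simpa using hy)
    rwa [← star_mul', hasLevel_star_iff]
  | h y h0 h1 =>
    -- Up to symmetry, the elements of norm below 5 are 0, 1, 1 + i and 2.
    have hre : y.re < 3 := by nlinarith
    have him : y.im < 2 := by nlinarith
    obtain ⟨u, v⟩ := y
    simp only at *
    have hu : 0 ≤ u := h0.trans h1
    interval_cases v <;> interval_cases u
    · exact absurd (zero_mul x) h.ne_zero
    · rwa [show (⟨1, 0⟩ : GaussianInt) = 1 from rfl, one_mul] at h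
    · exact HasLevel.of_two_mul h
    · exact HasLevel.of_one_add_I h
    · norm_num at hy

theorem exists_hasLevel {z : GaussianInt} (hz : z ≠ 0) : ∃ n, HasLevel n z := by
  obtain ⟨k, -, hk⟩ := exists_two_pow_dvd hz
  have hw : ∀ n : ℕ, (n : ℤ) ≤ octagonWidth n ∧ (n : ℤ) + 1 ≤ octagonWidth (n + 1) := by
    intro n
    induction n with
    | zero => decide
    | succ n ih =>
      have e : octagonWidth (n + 1 + 1) = 2 * octagonWidth n := rfl
      have : 3 ≤ octagonWidth n := octagonWidth_mono (Nat.zero_le n)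
      push_cast
      rcases Nat.eq_zero_or_pos n with rfl | h
      · decide
      · rw [e]; omega
  have hK : (0 : ℤ) < 2 ^ k := by positivity
  have h1 := abs_nonneg z.re
  have h2 := abs_nonneg z.im
  have h3 := hw (|z.re| + |z.im| + 3 * 2 ^ k).toNat
  rw [Int.toNat_of_nonneg (by positivity)] at h3
  exact ⟨(|z.re| + |z.im| + 3 * 2 ^ k).toNat, k, hk, by omega, by omega, by omega⟩

/-! ### The level is the minimal Euclidean function. -/

/-- The least level of a nonzero Gaussian integer. -/
noncomputable def level (z : GaussianInt) : ℕ := sInf {n | HasLevel n z}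

theorem hasLevel_level {z : GaussianInt} (hz : z ≠ 0) : HasLevel (level z) z :=
  Nat.sInf_mem (s := {n | HasLevel n z}) (exists_hasLevel hz)

theorem HasLevel.level_le {n : ℕ} {z : GaussianInt} (h : HasLevel n z) : level z ≤ n :=
  Nat.sInf_le h

theorem isEuclideanFunction_level :
    IsEuclideanFunction fun z : {z : GaussianInt // z ≠ 0} => (level z.1 : Ordinal.{0}) := by
  intro a b
  obtain ⟨q, hq⟩ := (hasLevel_level b.2).exists_sub a.1
  refine ⟨q, a.1 - q * b.1, by ring, hq.imp_right ?_⟩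
  rintro ⟨m, hm, h⟩
  exact ⟨h.ne_zero, Nat.cast_lt.2 (h.level_le.trans_lt hm)⟩

/-- Divide the test element g by b: the remainder is zero or, by induction, of level below n. So b
divides an element of level at most n. -/
theorem hasLevel_of_le {f : {z : GaussianInt // z ≠ 0} → Ordinal.{0}} (hf : IsEuclideanFunction f)
    (n : ℕ) (b : {z : GaussianInt // z ≠ 0}) (hb : f b ≤ n) : HasLevel n b.1 := by
  induction n using Nat.strong_induction_on generalizing b with
  | h n ih =>
  obtain ⟨g, hg, hsub⟩ := exists_hasLevel_sub n
  obtain ⟨q, r, hqr, hr⟩ := hf ⟨g, hg.ne_zero⟩ b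
  simp only at hqr
  rcases hr with rfl | ⟨hr0, hr⟩
  · refine HasLevel.of_mul (y := q) ?_
    rwa [← add_zero (q * b.1), ← hqr]
  · obtain ⟨m, hm⟩ := Ordinal.lt_omega0.1 ((hr.trans_le hb).trans (Ordinal.natCast_lt_omega0 n))
    have hmn : m < n := by exact_mod_cast hm ▸ hr.trans_le hb
    refine HasLevel.of_mul (y := q) ?_
    rw [show q * b.1 = g - r by rw [hqr]; ring]
    exact hsub m hmn r (ih m hmn ⟨r, hr0⟩ hm.le)

theorem level_le_of_isEuclideanFunction {f : {z : GaussianInt // z ≠ 0} → Ordinal.{0}}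
    (hf : IsEuclideanFunction f) (b : {z : GaussianInt // z ≠ 0}) : (level b.1 : Ordinal) ≤ f b := by
  by_contra! hlt
  obtain ⟨m, hm⟩ := Ordinal.lt_omega0.1 (hlt.trans (Ordinal.natCast_lt_omega0 _))
  have h := (hasLevel_of_le hf m b hm.le).level_le
  rw [hm] at hlt
  exact absurd h (not_le.2 (by exact_mod_cast hlt))

theorem minimalEuclideanFunction_eq_level (b : {z : GaussianInt // z ≠ 0}) :
    minimalEuclideanFunction b = level b.1 := by
  refine le_antisymm (csInf_le' ⟨_, isEuclideanFunction_level, rfl⟩) (le_csInf ?_ ?_)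
  · exact ⟨_, _, isEuclideanFunction_level, rfl⟩
  · rintro _ ⟨f, hf, rfl⟩
    exact level_le_of_isEuclideanFunction hf b

theorem minimalEuclideanFunction_gaussRemainder_lt {a b : GaussianInt} (hb : b ≠ 0)
    (h : emultiplicity 2 (gaussRemainder a b) ≤ emultiplicity 2 b) :
    ∃ hr : gaussRemainder a b ≠ 0,
      minimalEuclideanFunction ⟨gaussRemainder a b, hr⟩ < minimalEuclideanFunction ⟨b, hb⟩ := by
  have hnear := near_gaussRemainder a hb
  obtain ⟨j, hj, hj'⟩ := exists_two_pow_dvd hb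
  rw [emultiplicity_eq_coe.2 ⟨hj, hj'⟩] at h
  have hr : gaussRemainder a b ≠ 0 := by
    intro h0
    simp [h0] at h
  obtain ⟨k, hk, hk'⟩ := exists_two_pow_dvd hr
  rw [emultiplicity_eq_coe.2 ⟨hk, hk'⟩] at h
  refine ⟨hr, ?_⟩
  simp only [minimalEuclideanFunction_eq_level, Nat.cast_lt]
  have hlevel := hasLevel_level hb
  rcases hn : level b with _ | N
  · exact absurd (hnear.eq_zero (hn ▸ hlevel)) hr
  · rw [hn] at hlevel
    exact Nat.lt_succ_of_le (hlevel.of_near hj hj' (by exact_mod_cast h) hk hk' hnear).level_le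

end GaussianInt

theorem lemma4 (a b : GaussianInt) (ha : a ≠ 0) (hb : b ≠ 0) :
    (emultiplicity 2 (gaussRemainder a b) ≤ emultiplicity 2 b →
      ∃ hr : gaussRemainder a b ≠ 0,
        minimalEuclideanFunction ⟨gaussRemainder a b, hr⟩ < minimalEuclideanFunction ⟨b, hb⟩) ∧
    (emultiplicity 2 a < emultiplicity 2 b →
      ∃ hr : gaussRemainder a b ≠ 0,
        minimalEuclideanFunction ⟨gaussRemainder a b, hr⟩ < minimalEuclideanFunction ⟨b, hb⟩) := by
  refine ⟨GaussianInt.minimalEuclideanFunction_gaussRemainder_lt hb, fun h => ?_⟩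
  refine GaussianInt.minimalEuclideanFunction_gaussRemainder_lt hb (le_trans (le_of_eq ?_) h.le)
  -- Since v_2(a) < v_2(b), subtracting a multiple of b from a preserves the valuation exactly.
  refine le_antisymm (le_of_not_gt fun hlt => ?_) ?_
  · obtain ⟨k, hk, hk'⟩ := GaussianInt.exists_two_pow_dvd ha
    rw [emultiplicity_eq_coe.2 ⟨hk, hk'⟩] at h hlt
    have h1 : 2 ^ (k + 1) ∣ b := pow_dvd_of_le_emultiplicity (Order.add_one_le_of_lt h)
    have h2 : 2 ^ (k + 1) ∣ gaussRemainder a b :=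
      pow_dvd_of_le_emultiplicity (Order.add_one_le_of_lt hlt)
    exact hk' ((dvd_sub_left (h1.mul_left _)).1 h2)
  · obtain ⟨k, hk, hk'⟩ := GaussianInt.exists_two_pow_dvd ha
    rw [emultiplicity_eq_coe.2 ⟨hk, hk'⟩] at h ⊢
    have h1 : 2 ^ k ∣ b := pow_dvd_of_le_emultiplicity h.le
    exact le_emultiplicity_of_pow_dvd (dvd_sub hk (h1.mul_left _))
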